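/- Let $X$ be a complex Banach space and let $T$ be a bounded linear operator on $X$ with spectral radius $r(T)\le 1$ and with no eigenvectors. Let $e\in X$ and put $x_n=T^ne$ for $n=1,2,3,\dots$. Suppose that the sequence $(x_n)_{n\ge1}$ is minimal, i.e. for every $k$ the vector $x_k$ does not lie in the closed linear span of $\{x_i : i\ne k\}$; let $x_k^*$ be the (then well-defined and bounded) biorthogonal functional on $\operatorname{span}\{x_i\}_{i\ge1}$ given by $x_k^*\bigl(\sum_i\alpha_ix_i\bigr)=\alpha_k$, and let $\|x_k^*\|$ be its norm. If $$\sum_{n=1}^\infty\frac{\|x_n^*\|}{n}<\infty,$$ then $T$ has an almost invariant half-space: there is a closed subspace $Y\subseteq X$, of infinite dimension and of infinite codimension in $X$, and a finite-dimensional subspace $F\subseteq X$ such that $T(Y)\subseteq Y+F$. -/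

import Mathlib

noncomputable section

/-- A family `x` of vectors is minimal if no `x k` lies in the closed linear span of the others. -/
def IsMinimalFamily {ι X : Type*} [NormedAddCommGroup X] [NormedSpace ℂ X] (x : ι → X) : Prop :=
  ∀ k, x k ∉ (Submodule.span ℂ (x '' {k}ᶜ)).topologicalClosure

theorem IsMinimalFamily.linearIndependent {ι X : Type*} [NormedAddCommGroup X] [NormedSpace ℂ X]
    {x : ι → X} (hx : IsMinimalFamily x) : LinearIndependent ℂ x := by
  rw [linearIndependent_iff_notMem_span]
  intro k hk
  refine hx k (Submodule.le_topologicalClosure _ ?_)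
  rwa [Set.compl_eq_univ_sdiff]

/-- The algebraic coordinate functional `∑ αᵢ xᵢ ↦ αₖ` on the linear span of a linearly
independent family. -/
def spanCoord {ι X : Type*} [NormedAddCommGroup X] [NormedSpace ℂ X] {x : ι → X}
    (hx : LinearIndependent ℂ x) (k : ι) : Submodule.span ℂ (Set.range x) →ₗ[ℂ] ℂ :=
  Finsupp.lapply k ∘ₗ hx.repr

/-- The coordinate functionals of a minimal family are bounded. -/
theorem IsMinimalFamily.exists_bound {ι X : Type*} [NormedAddCommGroup X] [NormedSpace ℂ X]
    {x : ι → X} (hx : IsMinimalFamily x) (k : ι) :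
    ∃ C : ℝ, ∀ y, ‖spanCoord hx.linearIndependent k y‖ ≤ C * ‖y‖ := by
  classical
  set S : Submodule ℂ X := Submodule.span ℂ (x '' {k}ᶜ) with hS
  set d : ℝ := Metric.infDist (x k) (S : Set X) with hd
  have hne : (S : Set X).Nonempty := ⟨0, S.zero_mem⟩
  have hdpos : 0 < d := by
    have h : x k ∉ closure (S : Set X) := fun h => hx k h
    exact (Metric.infDist_pos_iff_notMem_closure hne).1 h
  refine ⟨d⁻¹, fun y => ?_⟩
  set c : ι →₀ ℂ := hx.linearIndependent.repr y with hc
  have hco : spanCoord hx.linearIndependent k y = c k := rfl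
  rw [hco]
  by_cases h0 : c k = 0
  · rw [h0, norm_zero]; positivity
  have hy : (y : X) = c k • x k + Finsupp.linearCombination ℂ x (c.erase k) := by
    have h1 : Finsupp.linearCombination ℂ x c = y :=
      hx.linearIndependent.linearCombination_repr y
    conv_lhs => rw [← h1, ← Finsupp.single_add_erase k c]
    rw [map_add, Finsupp.linearCombination_single]
  have hz : Finsupp.linearCombination ℂ x (c.erase k) ∈ S := by
    rw [hS, Finsupp.mem_span_image_iff_linearCombination]
    refine ⟨c.erase k, ?_, rfl⟩
    rw [Finsupp.mem_supported]
    intro i hi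
    simp only [Finsupp.support_erase, Finset.coe_erase, Set.mem_sdiff, Set.mem_singleton_iff] at hi
    exact hi.2
  have hle : d ≤ ‖(c k)⁻¹ • (y : X)‖ := by
    have h2 := Metric.infDist_le_dist_of_mem (x := x k)
      (S.neg_mem (S.smul_mem (c k)⁻¹ hz))
    rw [dist_eq_norm, sub_neg_eq_add] at h2
    rwa [hy, smul_add, smul_smul, inv_mul_cancel₀ h0, one_smul]
  rw [norm_smul, norm_inv] at hle
  have hck : 0 < ‖c k‖ := norm_pos_iff.2 h0
  rw [inv_mul_eq_div, le_div_iff₀ hck] at hle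
  rw [inv_mul_eq_div, le_div_iff₀ hdpos, mul_comm]
  exact hle

/-- The biorthogonal functional `xₖ*` of a minimal family, defined on the linear span of the
family by `∑ αᵢ xᵢ ↦ αₖ`, as a bounded functional; `‖xₖ*‖` is its operator norm. -/
def IsMinimalFamily.biorthogonal {ι X : Type*} [NormedAddCommGroup X] [NormedSpace ℂ X]
    {x : ι → X} (hx : IsMinimalFamily x) (k : ι) : Submodule.span ℂ (Set.range x) →L[ℂ] ℂ :=
  (spanCoord hx.linearIndependent k).mkContinuousOfExistsBound (hx.exists_bound k)

theorem IsMinimalFamily.biorthogonal_apply {ι X : Type*} [NormedAddCommGroup X]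
    [NormedSpace ℂ X] [DecidableEq ι] {x : ι → X} (hx : IsMinimalFamily x) (k i : ι) :
    hx.biorthogonal k ⟨x i, Submodule.subset_span ⟨i, rfl⟩⟩ = if i = k then 1 else 0 := by
  change hx.linearIndependent.repr _ k = _
  rw [hx.linearIndependent.repr_eq_single i _ rfl, Finsupp.single_apply]

/-- A half-space: a closed subspace of infinite dimension and infinite codimension. -/
def IsHalfSpace {X : Type*} [NormedAddCommGroup X] [NormedSpace ℂ X] (Y : Submodule ℂ X) : Prop :=
  IsClosed (Y : Set X) ∧ ¬ FiniteDimensional ℂ Y ∧ ¬ FiniteDimensional ℂ (X ⧸ Y)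

/-- `Y` is almost invariant under `T`: `T(Y) ⊆ Y + F` for some finite-dimensional `F`. -/
def IsAlmostInvariant {X : Type*} [NormedAddCommGroup X] [NormedSpace ℂ X]
    (T : X →L[ℂ] X) (Y : Submodule ℂ X) : Prop :=
  ∃ F : Submodule ℂ X, FiniteDimensional ℂ F ∧ ∀ y ∈ Y, T y ∈ Y ⊔ F

end

/-! Put `h m = (1 - z m • T)⁻¹ (T e)`, expanded as a Neumann series, for points `z m` of the
punctured unit disc, and let `Y` be the closed span of the `h m`. Since `z m • T (h m) = h m - T e`,
the space `Y` is invariant up to the line through `T e`. The points are zeros of `(1 - z) ^ I - (1 -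
z) ^ (-I) = 2 * I * sin (log (1 - z))`, whose Taylor coefficients `d n` are `O(1 / n)`. The
summability hypothesis is then exactly what makes `∑ d n • xₙ*` and its shifts bounded functionals
(`IsMinimalFamily.exists_functional`). They annihilate every `h m` and are triangular on the orbit,
so `Y` has infinite codimension. Coordinate functionals send `h m` to the geometric sequence of
ratio `z m`, so `Y` has infinite dimension. -/

open Filter Topology in
/-- If `r(T) ≤ 1` then `∑ ‖T ^ n‖ sⁿ` converges for `0 < s < 1`. -/
theorem summable_norm_pow_mul_pow_of_spectralRadius_le_one {A : Type*} [NormedRing A]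
    [NormedAlgebra ℂ A] [CompleteSpace A] (a : A) (ha : spectralRadius ℂ a ≤ 1) {s : ℝ}
    (hs0 : 0 < s) (hs1 : s < 1) : Summable fun n : ℕ => ‖a ^ n‖ * s ^ n := by
  obtain ⟨t, hst, ht1⟩ := exists_between hs1
  have ht0 : 0 < t := hs0.trans hst
  have hlt : spectralRadius ℂ a < ENNReal.ofReal t⁻¹ := by
    refine ha.trans_lt ?_
    rw [ENNReal.one_lt_ofReal]
    exact (one_lt_inv₀ ht0).2 ht1
  have hev := (spectrum.pow_norm_pow_one_div_tendsto_nhds_spectralRadius a).eventually_lt_const hlt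
  have hsum : Summable fun n : ℕ => (s / t) ^ n :=
    summable_geometric_of_lt_one (by positivity) ((div_lt_one ht0).2 hst)
  refine summable_of_isBigO_nat hsum (Asymptotics.IsBigO.of_bound 1 ?_)
  filter_upwards [hev, eventually_gt_atTop 0] with n hn hn0
  have h1 : ‖a ^ n‖ ^ (1 / n : ℝ) < t⁻¹ := (ENNReal.ofReal_lt_ofReal_iff (by positivity)).1 hn
  have h2 : ‖a ^ n‖ ≤ t⁻¹ ^ n := by
    have h3 := pow_le_pow_left₀ (by positivity) h1.le n
    rwa [one_div, Real.rpow_inv_natCast_pow (norm_nonneg _) hn0.ne'] at h3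
  rw [one_mul, Real.norm_of_nonneg (by positivity), Real.norm_of_nonneg (by positivity),
    div_eq_inv_mul, mul_pow]
  gcongr

/-! ### Binomial series with exponents `± I` -/

/-- The recurrence of the generalized binomial coefficients. -/
theorem Complex.succ_mul_choose_succ (a : ℂ) (n : ℕ) :
    ((n : ℂ) + 1) * Ring.choose a (n + 1) = (a - n) * Ring.choose a n := by
  have hn : (n.factorial : ℂ) ≠ 0 := by exact_mod_cast n.factorial_ne_zero
  have hn1 : (n : ℂ) + 1 ≠ 0 := by exact_mod_cast n.succ_ne_zero
  rw [Ring.choose_eq_smul, Ring.choose_eq_smul, descPochhammer_succ_right, Polynomial.smeval_mul,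
    Nat.factorial_succ]
  simp [Polynomial.smeval_natCast]
  field_simp

/-- For `a = ± i` the binomial coefficients of exponent `a` are `O(1 / n)`. -/
theorem Complex.natCast_mul_norm_choose_le {a : ℂ} (hre : a.re = 0) (him : a.im ^ 2 = 1) (n : ℕ) :
    n * ‖Ring.choose a n‖ ≤ 2 := by
  have hstep (n : ℕ) : ((n + 1 : ℕ) * ‖Ring.choose a (n + 1)‖) ^ 2
      = (1 + (n : ℝ) ^ 2) * ‖Ring.choose a n‖ ^ 2 := by
    have h := congrArg (fun z : ℂ => ‖z‖ ^ 2) (succ_mul_choose_succ a n)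
    simp only [norm_mul, mul_pow] at h
    have h1 : ‖(n : ℂ) + 1‖ = ((n + 1 : ℕ) : ℝ) := by
      rw [← Complex.norm_natCast]; push_cast; rfl
    have h2 : ‖a - n‖ ^ 2 = 1 + (n : ℝ) ^ 2 := by
      rw [Complex.sq_norm, Complex.normSq_apply]
      simp only [sub_re, sub_im, natCast_re, natCast_im, hre]
      linear_combination him
    rw [h1, h2] at h
    rw [mul_pow, h]
  -- With `N = n + 2` the bound is `4 * (1 - 1 / N)`, an equality at `N = 2`. It absorbs the growth
  -- factor `1 + 1 / N ^ 2` because `(N ^ 2 + 1) * (N ^ 2 - 1) ≤ N ^ 4`; a constant bound would not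
  -- propagate.
  have hbound (n : ℕ) : ((n + 2 : ℕ) * ‖Ring.choose a (n + 2)‖) ^ 2
      ≤ 4 * ((n : ℝ) + 1) / (n + 2) := by
    induction n with
    | zero =>
      rw [hstep 1]
      have h := hstep 0
      simp only [Ring.choose_zero_right, zero_add, Nat.cast_one, one_mul, Nat.cast_zero] at h
      rw [h]
      norm_num
    | succ n ih =>
      rw [show n + 1 + 2 = n + 2 + 1 from rfl, hstep (n + 2)]
      rw [mul_pow] at ih
      have h0 : (0 : ℝ) < ((n + 2 : ℕ) : ℝ) ^ 2 := by positivity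
      have h1 : ‖Ring.choose a (n + 2)‖ ^ 2
          ≤ 4 * ((n : ℝ) + 1) / (n + 2) / ((n + 2 : ℕ) : ℝ) ^ 2 := by
        rw [le_div_iff₀ h0]; linarith
      refine (mul_le_mul_of_nonneg_left h1 (by positivity)).trans ?_
      push_cast
      rw [div_div, mul_div_assoc', div_le_div_iff₀ (by positivity) (by positivity)]
      have hn : (0 : ℝ) ≤ n := n.cast_nonneg
      nlinarith [mul_nonneg hn hn, mul_nonneg hn (mul_nonneg hn hn)]
  match n with
  | 0 => simp
  | 1 =>
    have h := hstep 0
    simp only [Ring.choose_zero_right, zero_add, Nat.cast_one, one_mul, Nat.cast_zero,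
      norm_one] at h
    rw [Nat.cast_one, one_mul]
    nlinarith [norm_nonneg (Ring.choose a 1)]
  | n + 2 =>
    refine abs_le_of_sq_le_sq' ?_ (by norm_num) |>.2
    refine (hbound n).trans ?_
    rw [div_le_iff₀ (by positivity)]
    linarith

/-- The binomial series of `(1 - z) ^ a`. -/
theorem Complex.hasSum_one_sub_cpow (a : ℂ) {z : ℂ} (hz : ‖z‖ < 1) :
    HasSum (fun n : ℕ => (-1) ^ n * Ring.choose a n * z ^ n) ((1 - z) ^ a) := by
  have hmem : -z ∈ Metric.eball (0 : ℂ) 1 := by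
    rw [Metric.mem_eball, edist_zero_right, enorm_neg, ← ofReal_norm]
    exact ENNReal.ofReal_lt_one.2 hz
  have h := (one_add_cpow_hasFPowerSeriesOnBall_zero (a := a)).hasSum hmem
  rw [zero_add, ← sub_eq_add_neg] at h
  refine h.congr_fun ?_
  intro n
  rw [binomialSeries, FormalMultilinearSeries.ofScalars_apply_eq, neg_pow, smul_eq_mul]
  ring

/-- There is a power series with coefficients `O(1 / n)`, convergent on the unit disc, which
vanishes at infinitely many points of the punctured disc. -/
theorem exists_powerSeries_isBigO_inv_with_infinitely_many_zeros :
    ∃ (d : ℕ → ℂ) (z : ℕ → ℂ), d 0 = 0 ∧ d 1 ≠ 0 ∧ (∀ n, n * ‖d n‖ ≤ 4) ∧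
      Function.Injective z ∧ (∀ m, z m ≠ 0) ∧ (∀ m, ‖z m‖ < 1) ∧
      ∀ m, HasSum (fun n => d n * z m ^ n) 0 := by
  have hnorm (m : ℕ) : ‖(1 - Real.exp (-(Real.pi * (m + 1))) : ℂ)‖ < 1 := by
    rw [← Complex.ofReal_one, ← Complex.ofReal_sub, Complex.norm_real, Real.norm_eq_abs, abs_lt]
    have h1 := Real.exp_pos (-(Real.pi * (m + 1)))
    have h2 : Real.exp (-(Real.pi * (m + 1))) ≤ 1 :=
      Real.exp_le_one_iff.2 (by have := Real.pi_pos; rw [neg_nonpos]; positivity)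
    constructor <;> linarith
  -- The zeros solve `log (1 - z) = -π (m + 1)`; the shift by one excludes `z = 0`.
  refine ⟨fun n => (-1) ^ n * (Ring.choose Complex.I n - Ring.choose (-Complex.I) n),
    fun m => 1 - Real.exp (-(Real.pi * (m + 1))), by simp, ?_, ?_, ?_, ?_, hnorm, ?_⟩
  · simp only [Ring.choose_one_right, pow_one]
    intro h
    have := congrArg Complex.im h
    norm_num at this
  · intro n
    have h1 := Complex.natCast_mul_norm_choose_le (a := Complex.I) (by simp) (by simp) n
    have h2 := Complex.natCast_mul_norm_choose_le (a := -Complex.I) (by simp) (by simp) n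
    rw [norm_mul, norm_pow, norm_neg, norm_one, one_pow, one_mul]
    calc _ ≤ n * (‖Ring.choose Complex.I n‖ + ‖Ring.choose (-Complex.I) n‖) := by
          gcongr; exact norm_sub_le _ _
      _ ≤ 4 := by linarith
  · intro m k h
    have h1 : Real.exp (-(Real.pi * (m + 1))) = Real.exp (-(Real.pi * (k + 1))) := by
      exact_mod_cast sub_right_injective h
    have h2 := Real.exp_injective h1
    have h3 : (m : ℝ) + 1 = k + 1 := mul_left_cancel₀ Real.pi_ne_zero (neg_injective h2)
    exact_mod_cast add_right_cancel h3
  · intro m h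
    have h1 : Real.exp (-(Real.pi * (m + 1))) = 1 := by
      exact_mod_cast (sub_eq_zero.1 h).symm
    have h2 : 0 < Real.pi * (m + 1) := by have := Real.pi_pos; positivity
    rw [Real.exp_eq_one_iff] at h1
    linarith
  · intro m
    have h := (Complex.hasSum_one_sub_cpow Complex.I (hnorm m)).sub
      (Complex.hasSum_one_sub_cpow (-Complex.I) (hnorm m))
    have hval : (1 - (1 - (Real.exp (-(Real.pi * (m + 1))) : ℂ))) ^ Complex.I
        - (1 - (1 - (Real.exp (-(Real.pi * (m + 1))) : ℂ))) ^ (-Complex.I) = 0 := by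
      rw [sub_sub_cancel, Complex.cpow_neg, sub_eq_zero]
      have hne : (Real.exp (-(Real.pi * (m + 1))) : ℂ) ≠ 0 := by
        exact_mod_cast (Real.exp_pos _).ne'
      have hlog : Complex.log (Real.exp (-(Real.pi * (m + 1))) : ℂ)
          = ((-(Real.pi * (m + 1)) : ℝ) : ℂ) := by
        rw [← Complex.ofReal_log (Real.exp_pos _).le, Real.log_exp]
      refine eq_inv_of_mul_eq_one_left ?_
      rw [← Complex.cpow_add _ _ hne, Complex.cpow_def_of_ne_zero hne, hlog, Complex.exp_eq_one_iff]
      refine ⟨-(m + 1), ?_⟩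
      push_cast
      ring
    rw [hval] at h
    exact h.congr_fun fun n => by ring

/-! ### Functionals prescribed on a minimal family, and independence criteria -/

/-- If `(xₙ, φₙ)` is biorthogonal and `∑ |cₙ| ‖φₙ‖ < ∞`, then some bounded functional takes the
values `cₙ` at `xₙ`. -/
theorem exists_strongDual_of_biorthogonal {ι E : Type*} [DecidableEq ι] [NormedAddCommGroup E]
    [NormedSpace ℂ E] (x : ι → E) (φ : ι → E →L[ℂ] ℂ)
    (hφ : ∀ k i, φ k (x i) = if i = k then 1 else 0) (c : ι → ℂ)
    (hc : Summable fun n => ‖c n‖ * ‖φ n‖) : ∃ g : E →L[ℂ] ℂ, ∀ n, g (x n) = c n := by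
  have hs : Summable fun n => c n • φ n :=
    Summable.of_norm (hc.congr fun n => (norm_smul (c n) (φ n)).symm)
  obtain ⟨g, hg⟩ := hs
  refine ⟨g, fun n => ?_⟩
  have h2 := (ContinuousLinearMap.apply ℂ ℂ (x n)).hasSum hg
  refine h2.unique ((hasSum_ite_eq n (c n)).congr_fun fun k => ?_)
  change c k * φ k (x n) = _
  rw [hφ]
  by_cases h : k = n
  · simp [h]
  · simp [h, Ne.symm h]

/-- If `∑ |cₙ| ‖xₙ*‖ < ∞` then some bounded functional takes the values `cₙ` at `xₙ`. -/
theorem IsMinimalFamily.exists_functional {ι X : Type*} [NormedAddCommGroup X] [NormedSpace ℂ X]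
    {x : ι → X} (hx : IsMinimalFamily x) (c : ι → ℂ)
    (hc : Summable fun n => ‖c n‖ * ‖hx.biorthogonal n‖) :
    ∃ f : StrongDual ℂ X, ∀ n, f (x n) = c n := by
  classical
  obtain ⟨g, hg⟩ := exists_strongDual_of_biorthogonal
    (fun n => (⟨x n, Submodule.subset_span ⟨n, rfl⟩⟩ : Submodule.span ℂ (Set.range x)))
    hx.biorthogonal hx.biorthogonal_apply c hc
  obtain ⟨f, hf, -⟩ := exists_extension_norm_eq (𝕜 := ℂ) (Submodule.span ℂ (Set.range x)) g
  exact ⟨f, fun n => (hf ⟨x n, Submodule.subset_span ⟨n, rfl⟩⟩).trans (hg n)⟩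

/-- Distinct scalars give linearly independent geometric sequences. -/
theorem linearIndependent_geometric {ι K : Type*} [Field K] {z : ι → K}
    (hz : Function.Injective z) : LinearIndependent K fun m (n : ℕ) => z m ^ n := by
  -- Geometric sequences are characters of the monoid `ℕ`, so Dedekind's independence theorem
  -- applies.
  have h := (linearIndependent_monoidHom (Multiplicative ℕ) K).comp
    (fun m => powersHom K (z m)) ((powersHom K).injective.comp hz)
  exact h

/-- A triangular family of sequences with nonzero diagonal is linearly independent. -/
theorem linearIndependent_of_triangular {ι K : Type*} [LinearOrder ι] [Field K] {v : ι → ι → K}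
    (h0 : ∀ n k, n < k → v n k = 0) (h1 : ∀ n, v n n ≠ 0) : LinearIndependent K v := by
  rw [linearIndependent_iff]
  intro l hl
  by_contra hne
  have hsupp : l.support.Nonempty := Finsupp.support_nonempty_iff.2 hne
  set N := l.support.max' hsupp with hN
  have hNmem : N ∈ l.support := l.support.max'_mem hsupp
  have h2 := congrFun hl N
  rw [Finsupp.linearCombination_apply, Finsupp.sum, Finset.sum_apply,
    Finset.sum_eq_single_of_mem N hNmem] at h2
  · exact mul_ne_zero (Finsupp.mem_support_iff.1 hNmem) (h1 N) h2
  · intro n hn hnN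
    rw [Pi.smul_apply, h0 n N (lt_of_le_of_ne (l.support.le_max' n hn) hnN), smul_zero]

/-! ### The almost invariant half-space -/

theorem theorem4p1 {X : Type*} [NormedAddCommGroup X] [NormedSpace ℂ X] [CompleteSpace X]
    (T : X →L[ℂ] X) (hr : spectralRadius ℂ T ≤ 1)
    (hT : ∀ (μ : ℂ) (v : X), ¬ Module.End.HasEigenvector (T : X →ₗ[ℂ] X) μ v)
    (e : X) (hmin : IsMinimalFamily (fun n : ℕ+ => (T ^ (n : ℕ)) e))
    (hsum : Summable fun n : ℕ+ => ‖hmin.biorthogonal n‖ / (n : ℝ)) :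
    ∃ Y : Submodule ℂ X, IsHalfSpace Y ∧ IsAlmostInvariant T Y := by
  classical
  obtain ⟨d, z, hd0, hd1, hd, hzinj, hz0, hz1, hdz⟩ :=
    exists_powerSeries_isBigO_inv_with_infinitely_many_zeros
  set h : ℕ → X := fun m => ∑' n : ℕ, z m ^ n • (T ^ (n + 1)) e with hh
  have hs (m : ℕ) : Summable fun n : ℕ => z m ^ n • (T ^ (n + 1)) e := by
    have h1 := summable_norm_pow_mul_pow_of_spectralRadius_le_one T hr (norm_pos_iff.2 (hz0 m))
      (hz1 m)
    refine Summable.of_norm_bounded (h1.mul_left ‖T e‖) fun n => ?_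
    rw [norm_smul, norm_pow, pow_succ, show (T ^ n * T) e = (T ^ n) (T e) from rfl]
    have := (T ^ n).le_opNorm (T e)
    have h0 : 0 ≤ ‖z m‖ ^ n := by positivity
    nlinarith
  have hThm (m : ℕ) : h m = T e + z m • T (h m) := by
    have h1 : T (h m) = ∑' n : ℕ, z m ^ n • (T ^ (n + 1 + 1)) e := by
      rw [hh, T.map_tsum (hs m)]
      refine tsum_congr fun n => ?_
      rw [map_smul, pow_succ' T (n + 1)]
      rfl
    rw [h1, ← tsum_const_smul'']
    refine (hs m).tsum_eq_zero_add.trans ?_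
    simp only [pow_zero, one_smul, zero_add, pow_one, smul_smul, ← pow_succ']
  -- values of functionals at `h m`
  have hfun (f : StrongDual ℂ X) (m : ℕ) :
      HasSum (fun n : ℕ => z m ^ n * f ((T ^ (n + 1)) e)) (f (h m)) := by
    have h1 := (hs m).hasSum.mapL f
    simp only [map_smul, smul_eq_mul] at h1
    exact h1
  set Y : Submodule ℂ X := (Submodule.span ℂ (Set.range h)).topologicalClosure with hY
  have hYc : IsClosed (Y : Set X) := Submodule.isClosed_topologicalClosure _
  have hmem (m : ℕ) : h m ∈ Y := Submodule.le_topologicalClosure _ (Submodule.subset_span ⟨m, rfl⟩)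
  refine ⟨Y, ⟨hYc, ?_, ?_⟩, ?_⟩
  · have hcoord (n : ℕ) : ∃ f : StrongDual ℂ X, ∀ k : ℕ+,
        f ((T ^ (k : ℕ)) e) = if (k : ℕ) = n + 1 then 1 else 0 := by
      refine hmin.exists_functional (fun k : ℕ+ => if (k : ℕ) = n + 1 then 1 else 0) ?_
      refine summable_of_ne_finset_zero (s := {n.succPNat}) fun k hk => ?_
      have : (k : ℕ) ≠ n + 1 := fun h => hk (by simpa using PNat.eq h)
      simp [this]
    choose f hf using hcoord
    have hfh (n m : ℕ) : f n (h m) = z m ^ n := by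
      refine (hfun (f n) m).unique ?_
      convert hasSum_ite_eq n (z m ^ n) using 1
      ext k
      have := hf n k.succPNat
      simp only [Nat.succPNat_coe, Nat.succ_eq_add_one, add_left_inj] at this
      rw [this]
      by_cases hk : k = n <;> simp [hk]
    intro hfin
    have hli : LinearIndependent ℂ fun m => (⟨h m, hmem m⟩ : Y) := by
      refine LinearIndependent.of_comp
        ((LinearMap.pi fun n => (f n : X →ₗ[ℂ] ℂ)) ∘ₗ Y.subtype) ?_
      have heq : ((LinearMap.pi fun n => (f n : X →ₗ[ℂ] ℂ)) ∘ₗ Y.subtype) ∘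
          (fun m => (⟨h m, hmem m⟩ : Y)) = fun m (n : ℕ) => z m ^ n := by
        ext m n
        exact hfh n m
      rw [heq]
      exact linearIndependent_geometric hzinj
    exact not_finite_iff_infinite.2 inferInstance hli.finite
  -- Truncated subtraction together with `d 0 = 0` makes `d (n - k)` the sequence `d` shifted right
  -- by `k` and padded with zeros.
  · have hker (k : ℕ) : ∃ f : StrongDual ℂ X, ∀ n : ℕ+,
        f ((T ^ (n : ℕ)) e) = d (n - k) := by
      refine hmin.exists_functional (fun n : ℕ+ => d (n - k)) ?_
      refine Summable.of_nonneg_of_le (fun n => by positivity) (fun n => ?_)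
        (hsum.mul_left (4 * ((k : ℝ) + 1)))
      have hn : (0 : ℝ) < ((n : ℕ) : ℝ) := by exact_mod_cast n.pos
      rw [mul_div_assoc', le_div_iff₀ hn, mul_right_comm]
      refine mul_le_mul_of_nonneg_right ?_ (ContinuousLinearMap.opNorm_nonneg _)
      rcases le_or_gt (n : ℕ) k with hk | hk
      · rw [Nat.sub_eq_zero_of_le hk, hd0, norm_zero, zero_mul]; positivity
      · obtain ⟨j, hj⟩ := Nat.exists_eq_add_of_lt hk
        have h1 := hd (n - k)
        -- The shift costs only a factor `k + 1` in the `O(1 / n)` bound.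
        have h2 : ((n : ℕ) : ℝ) ≤ (k + 1) * ((n - k : ℕ) : ℝ) := by
          rw [hj, show k + j + 1 - k = j + 1 by omega]
          push_cast
          have : (0 : ℝ) ≤ (k : ℝ) * j := by positivity
          nlinarith
        calc _ ≤ ‖d (n - k)‖ * ((k + 1) * ((n - k : ℕ) : ℝ)) := by gcongr
          _ = (((n - k : ℕ) : ℝ) * ‖d (n - k)‖) * (k + 1) := by ring
          _ ≤ _ := by gcongr
    choose f hf using hker
    have hfh (k m : ℕ) : f k (h m) = 0 := by
      have h1 : HasSum (fun n : ℕ => z m ^ n * d (n - k)) 0 := by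
        rw [← hasSum_nat_add_iff' k, Finset.sum_eq_zero, sub_zero]
        · have h2 := (hdz m).mul_left (z m ^ k)
          rw [mul_zero] at h2
          exact h2.congr_fun fun n => by rw [Nat.add_sub_cancel, pow_add]; ring
        · intro n hn
          rw [Nat.sub_eq_zero_of_le (Finset.mem_range.1 hn).le, hd0, mul_zero]
      -- The series for `h m` starts at `T e`, not at `e`: the term `n = 0` vanishes, and one factor
      -- `z m` is divided out.
      rw [← hasSum_nat_add_iff' 1, Finset.sum_range_one, Nat.zero_sub, hd0, mul_zero,
        sub_zero] at h1
      have h3 := h1.mul_left (z m)⁻¹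
      rw [mul_zero] at h3
      refine (hfun (f k) m).unique (h3.congr_fun fun n => ?_)
      have h4 := hf k n.succPNat
      simp only [Nat.succPNat_coe, Nat.succ_eq_add_one] at h4
      rw [h4, pow_succ', mul_assoc, inv_mul_cancel_left₀ (hz0 m)]
    have hfY (k : ℕ) (y : X) (hy : y ∈ Y) : f k y = 0 := by
      have hle : Y ≤ (f k).ker := by
        refine Submodule.topologicalClosure_minimal _ ?_ (f k).isClosed_ker
        rw [Submodule.span_le]
        rintro _ ⟨m, rfl⟩
        exact hfh k m
      exact hle hy
    intro hfin
    have hli : LinearIndependent ℂ fun n : ℕ => Y.mkQ ((T ^ (n + 1)) e) := by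
      refine LinearIndependent.of_comp
        (LinearMap.pi fun k => Y.liftQ (f k : X →ₗ[ℂ] ℂ) fun y hy => hfY k y hy) ?_
      -- The matrix entry is `d (n + 1 - k)`: it is `d 0 = 0` for `n < k` and `d 1 ≠ 0` on the
      -- diagonal.
      refine linearIndependent_of_triangular (fun n k hnk => ?_) fun n => ?_
      · have h4 := hf k n.succPNat
        simp only [Nat.succPNat_coe, Nat.succ_eq_add_one] at h4
        refine h4.trans ?_
        rw [Nat.sub_eq_zero_of_le hnk, hd0]
      · have h4 := hf n n.succPNat
        simp only [Nat.succPNat_coe, Nat.succ_eq_add_one, Nat.add_sub_cancel_left] at h4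
        exact h4.trans_ne hd1
    exact not_finite_iff_infinite.2 inferInstance hli.finite
  · refine ⟨Submodule.span ℂ {T e}, inferInstance, fun y hy => ?_⟩
    -- Closedness of `Y ⊔ F` carries the inclusion from the span of the `h m` to its closure.
    have hcl : IsClosed ((Y ⊔ Submodule.span ℂ {T e} : Submodule ℂ X) : Set X) :=
      Submodule.isClosed_sup_finiteDimensional _ _ hYc
    have hle : Y ≤ (Y ⊔ Submodule.span ℂ {T e}).comap (T : X →ₗ[ℂ] X) := by
      refine Submodule.topologicalClosure_minimal _ ?_ (hcl.preimage T.continuous)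
      rw [Submodule.span_le]
      rintro _ ⟨m, rfl⟩
      have h1 : T (h m) = (z m)⁻¹ • (h m - T e) := by
        rw [eq_inv_smul_iff₀ (hz0 m), eq_sub_iff_add_eq, add_comm]
        exact (hThm m).symm
      change T (h m) ∈ Y ⊔ Submodule.span ℂ {T e}
      rw [h1]
      exact Submodule.smul_mem _ _ (Submodule.sub_mem _ (Submodule.mem_sup_left (hmem m))
        (Submodule.mem_sup_right (Submodule.mem_span_singleton_self _)))
    exact hle hy
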